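/- Let $\mathcal A$ be a finite alphabet and $\mathcal F$ a finite set of forbidden patterns $w\in\mathcal A^{I(w)}$ with finite non-empty windows $I(w)\subset\mathbb Z$. Let $\Omega_{\mathcal F}\subset\mathcal A^{\mathbb Z}$ be the subshift of finite type (SFT) of configurations containing no translate of a pattern of $\mathcal F$, and let $d(\mathcal F)=\max_{w\in\mathcal F}(\max I(w)-\min I(w))$. A finite word is locally admissible if it contains no pattern of $\mathcal F$. *Word automaton.* The states of $G_{\mathcal F}$ are the locally admissible words of length $d(\mathcal F)$. There is a transition from the length-$d(\mathcal F)$ prefix to the length-$d(\mathcal F)$ suffix of each locally admissible word of length $d(\mathcal F)+1$, so that the bi-infinite paths of $G_{\mathcal F}$ are exactly the configurations of $\Omega_{\mathcal F}$. Two states communicate if there are non-trivial paths from each to the other. $G_{\mathcal F}$ is irreducible if it has exactly one communication class (there may be further states lying on no cycle), and $p$-periodic if $p$ is the greatest common divisor of the lengths of its cycles. *Measures.* Let $\mathcal M_{\mathcal F}$ be the set of shift-invariant probability measures on $\mathcal A^{\mathbb Z}$ carried by $\Omega_{\mathcal F}$. For a class $\mathcal N$ of shift-invariant probability measures on $\{0,1\}^{\mathbb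 Z}$, let $\mathcal M^{\mathcal N}_{\mathcal F}(\epsilon)$ be the set of projections to $\mathcal A^{\mathbb Z}$ of the shift-invariant probability measures $\lambda$ on $(\mathcal A\times\{0,1\})^{\mathbb Z}$ such that $\lambda$-almost surely no pattern of $\mathcal F$ occurs on cells all labelled $0$, and the projection of $\lambda$ to $\{0,1\}^{\mathbb Z}$ belongs to $\mathcal N$ and gives the event that a given cell is labelled $1$ probability at most $\epsilon$. Let $\mathcal B$ be the class of all Bernoulli product measures on $\{0,1\}^{\mathbb Z}$. *Besicovitch distance.* Put $d_H(x,y)=\limsup_{n\to\infty}\frac{1}{2n+1}\#\{|k|\le n: x_k\ne y_k\}$. For shift-invariant $\mu,\nu$, let $d_B(\mu,\nu)$ be the infimum of $\int d_H\,d\lambda$ over all shift-invariant couplings $\lambda$ of $\mu$ and $\nu$, and let $d_B(\mu,\mathcal M_{\mathcal F})=\inf_{\nu\in\mathcal M_{\mathcal F}}d_B(\mu,\nu)$. The SFT is stable on $\mathcal N$ if there is a non-decreasing $f:[0,1]\to[0,\infty)$ with $f(0)=0$, right-continuous at $0$, such that $d_B(\mu,\mathcal M_{\mathcal F})\le f(\epsilon)$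 for all $\epsilon\in[0,1]$ and all $\mu\in\mathcal M_{\mathcal F}^{\mathcal N}(\epsilon)$. Otherwise it is unstable on $\mathcal N$. **Theorem (1D periodic instability).** If $G_{\mathcal F}$ is irreducible and $p$-periodic with $p\ge 2$, then for every $\epsilon>0$ there is $\mu_\epsilon\in\mathcal M^{\mathcal B}_{\mathcal F}(\epsilon)$ such that $$d_B(\mu_\epsilon,\mathcal M_{\mathcal F})\ \ge\ \frac{p-1}{p\,d(\mathcal F)}-\epsilon .$$ Consequently the SFT is unstable for $d_B$, both on the class $\mathcal B$ of Bernoulli noises and on the class of all shift-invariant noises. -/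

import Mathlib

open MeasureTheory ProbabilityTheory Filter

noncomputable section

namespace NoisySFT

/-! ### One-dimensional subshifts of finite type -/

/-- A finite pattern: a letter for each cell of a finite non-empty window `I ⊂ ℤ`
(the window need not be an interval). -/
structure Pattern (A : Type*) where
  window : Finset ℤ
  nonempty : window.Nonempty
  letter : window → A

/-- The diameter `max I - min I` of the window `I` of a pattern. -/
def Pattern.diam {A : Type*} (w : Pattern A) : ℕ :=
  (w.window.max' w.nonempty - w.window.min' w.nonempty).toNat

/-- The maximal diameter `d(F)` of a finite set of patterns. -/
def diam {A : Type*} (F : Finset (Pattern A)) : ℕ :=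
  F.sup Pattern.diam

/-- The shift `σ_k`, with `σ_k(x)_l = x_{k+l}`. -/
def shift {A : Type*} (k : ℤ) (x : ℤ → A) : ℤ → A :=
  fun l => x (k + l)

/-- The SFT `Ω_F`: configurations in which no pattern of `F` occurs anywhere. -/
def sft {A : Type*} (F : Set (Pattern A)) : Set (ℤ → A) :=
  {x | ∀ w ∈ F, ∀ k : ℤ, (fun i : w.window => shift k x i) ≠ w.letter}

/-! ### The word automaton -/

/-- The pattern `w` occurs in the finite word `u = u₀ … u_{n-1}`: some translate of the whole
window of `w` fits inside `{0, …, n-1}`, and `u` reads `w` there. -/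
def OccursIn {A : Type*} {n : ℕ} (w : Pattern A) (u : Fin n → A) : Prop :=
  ∃ k : ℤ, ∀ i : w.window, ∃ j : Fin n, (j : ℤ) = k + (i : ℤ) ∧ u j = w.letter i

/-- A finite word is locally admissible if it contains no forbidden pattern. -/
def LocallyAdmissible {A : Type*} (F : Finset (Pattern A)) {n : ℕ} (u : Fin n → A) : Prop :=
  ∀ w ∈ F, ¬ OccursIn w u

/-- The states of `G_F`: locally admissible words of length `d(F)`. -/
abbrev State {A : Type*} (F : Finset (Pattern A)) : Type _ :=
  {u : Fin (diam F) → A // LocallyAdmissible F u}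

/-- The transitions of `G_F`: from the prefix to the suffix (of length `d(F)`) of a locally
admissible word of length `d(F) + 1`, i.e. `au → ub` where `aub` contains no forbidden pattern.
A pattern of maximal diameter `d(F)` occupies `d(F) + 1` consecutive cells, so this is what makes
the bi-infinite paths of `G_F` correspond exactly to the configurations of `Ω_F`. -/
def Transition {A : Type*} (F : Finset (Pattern A)) (u v : State F) : Prop :=
  ∃ x : Fin (diam F + 1) → A, LocallyAdmissible F x ∧
    (∀ i : Fin (diam F), u.1 i = x i.castSucc) ∧ (∀ i : Fin (diam F), v.1 i = x i.succ)

/-- Two states communicate if there are (non-trivial) paths both ways; in particular `u`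
communicates with itself iff it lies on a cycle. -/
def Communicate {A : Type*} (F : Finset (Pattern A)) (u v : State F) : Prop :=
  Relation.TransGen (Transition F) u v ∧ Relation.TransGen (Transition F) v u

/-- Communication classes: the classes of the partial equivalence relation `Communicate`. -/
def IsCommClass {A : Type*} (F : Finset (Pattern A)) (C : Set (State F)) : Prop :=
  ∃ u : State F, Communicate F u u ∧ C = {v | Communicate F u v}

/-- `G_F` is irreducible if it has exactly one communication class. -/
def Irreducible {A : Type*} (F : Finset (Pattern A)) : Prop :=
  ∃! C : Set (State F), IsCommClass F C

/-- `n` is the length of a cycle (closed path) of `G_F`. -/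
def IsCycleLength {A : Type*} (F : Finset (Pattern A)) (n : ℕ) : Prop :=
  0 < n ∧ ∃ c : ℕ → State F, c n = c 0 ∧ ∀ i < n, Transition F (c i) (c (i + 1))

/-- `p` is the greatest common divisor of the lengths of all the cycles of `G_F`. -/
def IsPeriod {A : Type*} (F : Finset (Pattern A)) (p : ℕ) : Prop :=
  (∀ n, IsCycleLength F n → p ∣ n) ∧ ∀ k : ℕ, (∀ n, IsCycleLength F n → k ∣ n) → k ∣ p

/-! ### Invariant measures and noisy measures -/

/-- `M_A`: shift-invariant probability measures on the full shift. -/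
def invariantMeasures (A : Type*) [MeasurableSpace A] : Set (Measure (ℤ → A)) :=
  {μ | IsProbabilityMeasure μ ∧ ∀ k : ℤ, μ.map (shift k) = μ}

/-- `M_F`: shift-invariant probability measures carried by the SFT `Ω_F`. -/
def sftMeasures {A : Type*} [MeasurableSpace A] (F : Set (Pattern A)) : Set (Measure (ℤ → A)) :=
  {μ | μ ∈ invariantMeasures A ∧ ∀ᵐ x ∂μ, x ∈ sft F}

/-- The clear pattern `(w, 0^I)` over `A × {0,1}`; the letter `b : Bool` of the second component
is `false` (`0`) on clear cells and `true` (`1`) on obscured cells. -/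
def Pattern.clear {A : Type*} (w : Pattern A) : Pattern (A × Bool) where
  window := w.window
  nonempty := w.nonempty
  letter := fun i => (w.letter i, false)

/-- Cellwise first projection of configurations. -/
def proj₁ {A B : Type*} (x : ℤ → A × B) : ℤ → A := fun k => (x k).1

/-- Cellwise second projection of configurations. -/
def proj₂ {A B : Type*} (x : ℤ → A × B) : ℤ → B := fun k => (x k).2

/-- An `ε`-noise: an invariant measure on `{0,1}^ℤ` under which a given cell is obscured with
probability at most `ε`. -/
def IsNoise (ε : ℝ) (ν : Measure (ℤ → Bool)) : Prop :=
  ν ∈ invariantMeasures Bool ∧ ν.real {b | b 0 = true} ≤ ε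

/-- Invariant measures on `(A × {0,1})^ℤ` without forbidden clear pattern, whose noise is an
`ε`-noise in the class `N`. -/
def noisyMeasuresLift {A : Type*} [MeasurableSpace A] (F : Finset (Pattern A))
    (N : Set (Measure (ℤ → Bool))) (ε : ℝ) : Set (Measure (ℤ → A × Bool)) :=
  {l | l ∈ sftMeasures (Pattern.clear '' (F : Set (Pattern A))) ∧
    l.map proj₂ ∈ N ∧ IsNoise ε (l.map proj₂)}

/-- `M_F^N(ε)`: the projections on `A^ℤ` of the measures of `noisyMeasuresLift F N ε`. -/
def noisyMeasures {A : Type*} [MeasurableSpace A] (F : Finset (Pattern A))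
    (N : Set (Measure (ℤ → Bool))) (ε : ℝ) : Set (Measure (ℤ → A)) :=
  (fun l => l.map proj₁) '' noisyMeasuresLift F N ε

/-- The class `B` of Bernoulli noises: each cell is obscured with probability `δ`, independently
of the other cells, for some `δ ∈ [0,1]`. -/
def bernoulliNoises : Set (Measure (ℤ → Bool)) :=
  {ν | ∃ δ : unitInterval, ν = Measure.infinitePi (fun _ : ℤ => bernoulliMeasure true false δ)}

/-! ### Besicovitch distance and stability -/

open Classical in
/-- The Hamming distance on a finite window `I`: the proportion of cells where `x` and `y`
differ. -/
def hammingDist {A : Type*} (I : Finset ℤ) (x y : ℤ → A) : ℝ :=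
  ((I.filter (fun k => x k ≠ y k)).card : ℝ) / (I.card : ℝ)

/-- The Hamming–Besicovitch pseudometric, along the windows `{-n, …, n}`. -/
def dH {A : Type*} (x y : ℤ → A) : ℝ :=
  limsup (fun n : ℕ => hammingDist (Finset.Icc (-(n : ℤ)) (n : ℤ)) x y) atTop

/-- Couplings: invariant measures on `(A × A)^ℤ` with marginals `μ` and `ν`. -/
def couplings {A : Type*} [MeasurableSpace A] (μ ν : Measure (ℤ → A)) :
    Set (Measure (ℤ → A × A)) :=
  {l | l ∈ invariantMeasures (A × A) ∧ l.map proj₁ = μ ∧ l.map proj₂ = ν}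

/-- The Besicovitch distance between invariant measures. -/
def dB {A : Type*} [MeasurableSpace A] (μ ν : Measure (ℤ → A)) : ℝ :=
  sInf ((fun l => ∫ z, dH (proj₁ z) (proj₂ z) ∂l) '' couplings μ ν)

/-- The Besicovitch distance from a measure to a set of measures. -/
def dBSet {A : Type*} [MeasurableSpace A] (μ : Measure (ℤ → A)) (M : Set (Measure (ℤ → A))) : ℝ :=
  sInf ((fun ν => dB μ ν) '' M)

/-- `Ω_F` is `f`-stable for `d_B` on the class `N`. -/
def IsStableWith {A : Type*} [MeasurableSpace A] (F : Finset (Pattern A))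
    (N : Set (Measure (ℤ → Bool))) (f : unitInterval → NNReal) : Prop :=
  ∀ ε : unitInterval, ∀ μ ∈ noisyMeasures F N ε, dBSet μ (sftMeasures (F : Set (Pattern A))) ≤ f ε

/-- `Ω_F` is stable for `d_B` on the class `N`: it is `f`-stable for some non-decreasing
`f : [0,1] → ℝ⁺` with `f 0 = 0` that is (right-)continuous at `0`. -/
def IsStable {A : Type*} [MeasurableSpace A] (F : Finset (Pattern A))
    (N : Set (Measure (ℤ → Bool))) : Prop :=
  ∃ f : unitInterval → NNReal, Monotone f ∧ f 0 = 0 ∧ ContinuousAt f 0 ∧ IsStableWith F N f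

end NoisySFT

end

/-! Irreducibility and `p`-periodicity give every word of length `d(F)` a phase in `ZMod p` that
advances by one per cell along any configuration of the SFT (`exists_phase`). An invariant measure
on the SFT therefore gives each phase mass `1/p`, and each phase event is invariant under the `p`-th
power of the shift.

The noise can erase the phase. A run of `d(F)` obscured cells separates its two sides, so a fixed
configuration of the SFT may be read afresh from the end of every such run without creating a clear
forbidden pattern (`restart_mem_sft`). The result is an equivariant image of the Bernoulli noise,
hence ergodic under the `p`-th power of the shift (`ergodic_shift_infinitePi`).

In any coupling with a measure on the SFT, the phase of the SFT side is then independent of the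
noisy side (`measure_preimage_inter_of_ergodic_factor`), so the two phases agree with probability at
most `1/p`. When they differ, the words on cells `0, …, d(F) - 1` differ, and a union bound gives
mismatch probability at least `(p-1)/(p d(F))` at a cell (`le_measureReal_ne_of_mem_couplings`).
Reverse Fatou transfers this to `d_B` (`le_integral_dH`). The bound does not depend on the noise
level, whence instability. -/

noncomputable section

namespace NoisySFT

section

variable {A : Type*} {F : Finset (Pattern A)}

/-! ### Walks in the word automaton -/

/-- Walks of a given length in `G_F`. -/
inductive Walk (F : Finset (Pattern A)) : ℕ → State F → State F → Prop
  | nil (u : State F) : Walk F 0 u u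
  | cons {n : ℕ} {u v w : State F} (h : Transition F u v) (hw : Walk F n v w) : Walk F (n + 1) u w

theorem Walk.append {m n : ℕ} {u v w : State F} (h₁ : Walk F m u v) (h₂ : Walk F n v w) :
    Walk F (m + n) u w := by
  induction h₁ with
  | nil u => simpa using h₂
  | @cons k u v' w' h _ ih =>
    have := Walk.cons h (ih h₂)
    rwa [show k + 1 + n = k + n + 1 by omega]

theorem Walk.exists_seq {n : ℕ} {u v : State F} (h : Walk F n u v) :
    ∃ c : ℕ → State F, c 0 = u ∧ c n = v ∧ ∀ i < n, Transition F (c i) (c (i + 1)) := by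
  induction h with
  | nil u => exact ⟨fun _ => u, rfl, rfl, by simp⟩
  | @cons n u v w h _ ih =>
    obtain ⟨c, h0, hn, hc⟩ := ih
    refine ⟨fun i => Nat.casesOn i u c, rfl, hn, ?_⟩
    rintro (_ | i) hi
    · simpa [h0] using h
    · exact hc i (by omega)

theorem exists_walk_of_transGen {u v : State F} (h : Relation.TransGen (Transition F) u v) :
    ∃ n, 0 < n ∧ Walk F n u v := by
  induction h with
  | single h => exact ⟨1, one_pos, .cons h (.nil _)⟩
  | tail _ h ih =>
    obtain ⟨n, _, hw⟩ := ih
    exact ⟨n + 1, by omega, hw.append (.cons h (.nil _))⟩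

theorem Walk.isCycleLength {n : ℕ} {u : State F} (h : Walk F n u u) (hn : 0 < n) :
    IsCycleLength F n := by
  obtain ⟨c, h0, h1, hc⟩ := h.exists_seq
  exact ⟨hn, c, by rw [h0, h1], hc⟩

theorem Irreducible.exists_communicate (h : Irreducible F) :
    ∃ u : State F, Communicate F u u ∧ ∀ v, Communicate F v v → Communicate F u v := by
  obtain ⟨C, ⟨u, hu, hC⟩, huniq⟩ := h
  refine ⟨u, hu, fun v hv => ?_⟩
  have hvC := huniq _ ⟨v, hv, rfl⟩
  have : v ∈ C := hvC ▸ (show v ∈ {w | Communicate F v w} from hv)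
  rw [hC] at this
  exact this

/-- Closing both walks by the same return walk yields two cycles, whose lengths are divisible by
`p`. -/
theorem IsPeriod.walk_length_congr {p : ℕ} (hper : IsPeriod F p) {u v : State F}
    (hvu : Relation.TransGen (Transition F) v u) {m n : ℕ} (hm : Walk F m u v)
    (hn : Walk F n u v) : (m : ZMod p) = n := by
  obtain ⟨k, hk, hw⟩ := exists_walk_of_transGen hvu
  have h1 := hper.1 _ ((hm.append hw).isCycleLength (by omega))
  have h2 := hper.1 _ ((hn.append hw).isCycleLength (by omega))
  rw [← ZMod.natCast_eq_zero_iff] at h1 h2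
  push_cast at h1 h2
  exact add_right_cancel (h1.trans h2.symm)

/-! ### Paths of the automaton and configurations of the subshift -/

theorem locallyAdmissible_of_mem_sft {y : ℤ → A} (hy : y ∈ sft (F : Set (Pattern A))) (k : ℤ)
    (n : ℕ) : LocallyAdmissible F (fun i : Fin n => y (k + i)) := by
  rintro w hw ⟨l, hl⟩
  refine hy w hw (k + l) (funext fun i => ?_)
  obtain ⟨j, hj, hij⟩ := hl i
  simp only [hj] at hij
  rw [← hij, shift, add_assoc]

/-- The state of `G_F` read at position `k` of a configuration of the subshift. -/
def stateAt {y : ℤ → A} (hy : y ∈ sft (F : Set (Pattern A))) (k : ℤ) : State F :=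
  ⟨fun i => y (k + i), locallyAdmissible_of_mem_sft hy k _⟩

theorem transition_stateAt {y : ℤ → A} (hy : y ∈ sft (F : Set (Pattern A))) (k : ℤ) :
    Transition F (stateAt hy k) (stateAt hy (k + 1)) := by
  refine ⟨fun i => y (k + i), locallyAdmissible_of_mem_sft hy k _, fun i => rfl, fun i => ?_⟩
  simp only [stateAt, Fin.val_succ]
  congr 1
  push_cast
  ring

theorem transGen_stateAt {y : ℤ → A} (hy : y ∈ sft (F : Set (Pattern A))) {k l : ℤ} (h : k < l) :
    Relation.TransGen (Transition F) (stateAt hy k) (stateAt hy l) := by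
  induction l, (show k + 1 ≤ l by omega) using Int.leInduction with
  | base => exact .single (transition_stateAt hy k)
  | succ l hl ih => exact (ih (by omega)).tail (transition_stateAt hy l)

/-- Pigeonhole: with finitely many states, some state recurs to the right of `k`, and so lies on a
cycle. -/
theorem exists_communicate_stateAt_ge [Finite A] {y : ℤ → A}
    (hy : y ∈ sft (F : Set (Pattern A))) (k : ℤ) :
    ∃ l > k, Communicate F (stateAt hy l) (stateAt hy l) := by
  obtain ⟨i, j, hij, h⟩ := Finite.exists_ne_map_eq_of_infinite
    (fun n : ℕ => stateAt hy (k + 1 + n))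
  wlog hlt : i < j generalizing i j
  · exact this j i hij.symm h.symm (by omega)
  have := transGen_stateAt hy (show k + 1 + (i : ℤ) < k + 1 + j by omega)
  rw [← show stateAt hy _ = stateAt hy _ from h] at this
  exact ⟨_, by omega, this, this⟩

theorem exists_communicate_stateAt_le [Finite A] {y : ℤ → A}
    (hy : y ∈ sft (F : Set (Pattern A))) (k : ℤ) :
    ∃ l < k, Communicate F (stateAt hy l) (stateAt hy l) := by
  obtain ⟨i, j, hij, h⟩ := Finite.exists_ne_map_eq_of_infinite
    (fun n : ℕ => stateAt hy (k - 1 - n))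
  wlog hlt : i < j generalizing i j
  · exact this j i hij.symm h.symm (by omega)
  have := transGen_stateAt hy (show k - 1 - (j : ℤ) < k - 1 - i by omega)
  rw [← show stateAt hy _ = stateAt hy _ from h] at this
  exact ⟨_, by omega, this, this⟩

/-- States lying on no cycle may exist in the automaton, but a bi-infinite path never visits them:
each of its positions is between two states of the unique class. -/
theorem communicate_stateAt [Finite A] {u : State F}
    (hu : ∀ v, Communicate F v v → Communicate F u v) {y : ℤ → A}
    (hy : y ∈ sft (F : Set (Pattern A))) (k : ℤ) : Communicate F u (stateAt hy k) := by
  obtain ⟨l, hl, hcl⟩ := exists_communicate_stateAt_le hy k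
  obtain ⟨m, hm, hcm⟩ := exists_communicate_stateAt_ge hy k
  exact ⟨(hu _ hcl).1.trans (transGen_stateAt hy hl),
    (transGen_stateAt hy hm).trans (hu _ hcm).2⟩

/-- The cyclic decomposition of an irreducible periodic automaton: a phase, read on the words of
length `d(F)`, that increases by one at each step along the configurations of the subshift. -/
theorem exists_phase [Finite A] {p : ℕ} (hirr : Irreducible F) (hper : IsPeriod F p) :
    ∃ φ : (Fin (diam F) → A) → ZMod p, ∀ y ∈ sft (F : Set (Pattern A)), ∀ k : ℤ,
      φ (fun i => y (k + i)) = φ (fun i => y i) + k := by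
  classical
  obtain ⟨u, -, hu⟩ := hirr.exists_communicate
  let P : (Fin (diam F) → A) → ℕ → Prop := fun v n => ∃ h : LocallyAdmissible F v,
    Walk F n u ⟨v, h⟩
  -- The phase is the length mod `p` of a chosen walk from `u`. It is independent of the choice on
  -- the class of `u`; the default `0` and the values on other words play no role.
  let φ : (Fin (diam F) → A) → ZMod p := fun v => if h : ∃ n, P v n then (h.choose : ZMod p) else 0
  have hφ : ∀ v : State F, Communicate F u v → ∀ n, Walk F n u v → φ v.1 = n := by
    intro v hv n hn
    have h : ∃ n, P v.1 n := ⟨n, v.2, hn⟩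
    simp only [φ, dif_pos h]
    obtain ⟨_, h2⟩ := h.choose_spec
    exact hper.walk_length_congr hv.2 h2 hn
  have hstep : ∀ y (hy : y ∈ sft (F : Set (Pattern A))) (k : ℤ),
      φ (stateAt hy (k + 1)).1 = φ (stateAt hy k).1 + 1 := by
    intro y hy k
    have h0 := communicate_stateAt hu hy k
    obtain ⟨n, -, hn⟩ := exists_walk_of_transGen h0.1
    rw [hφ _ h0 n hn, hφ _ (communicate_stateAt hu hy (k + 1)) (n + 1)
      (hn.append (.cons (transition_stateAt hy k) (.nil _)))]
    push_cast
    rfl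
  refine ⟨φ, fun y hy k => ?_⟩
  have hall : ∀ k : ℤ, φ (stateAt hy k).1 = φ (stateAt hy 0).1 + k := by
    intro k
    induction k using Int.induction_on with
    | zero => simp
    | succ k ih => rw [hstep, ih]; push_cast; ring
    | pred k ih =>
      have := hstep y hy (-(k : ℤ) - 1)
      rw [sub_add_cancel, ih] at this
      rw [← sub_eq_iff_eq_add.2 this]
      push_cast
      ring
  simpa [stateAt] using hall k

/-- If `d(F) = 0`, the empty word is the only possible state, so a cycle forces a loop of length 1,
against `p ≥ 2`. -/
theorem diam_pos {p : ℕ} (hp : 2 ≤ p) (hirr : Irreducible F) (hper : IsPeriod F p) :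
    0 < diam F := by
  by_contra! h0
  have hsub : Subsingleton (State F) := by
    have : IsEmpty (Fin (diam F)) := by
      rw [Nat.le_zero.1 h0]; infer_instance
    exact ⟨fun a b => Subtype.ext (Subsingleton.elim _ _)⟩
  obtain ⟨u, ⟨hu, -⟩, -⟩ := hirr.exists_communicate
  obtain ⟨v, hv, -⟩ := Relation.TransGen.head'_iff.1 hu
  have := hper.1 1 ⟨one_pos, fun _ => u, rfl, fun _ _ => by
    rwa [Subsingleton.elim v u] at hv⟩
  have := Nat.le_of_dvd one_pos this
  omega

theorem sub_le_diam {w : Pattern A} (hw : w ∈ F) {i : ℤ} (hi : i ∈ w.window) :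
    w.window.min' w.nonempty ≤ i ∧ i ≤ w.window.min' w.nonempty + diam F := by
  have h1 := w.window.min'_le i hi
  have h2 := w.window.le_max' i hi
  have h3 : w.diam ≤ diam F := Finset.le_sup (f := Pattern.diam) hw
  rw [Pattern.diam] at h3
  omega

/-- Bi-infinite paths of `G_F` read configurations of the subshift. -/
theorem mem_sft_of_path (hd : 0 < diam F) (s : ℤ → State F)
    (hs : ∀ k, Transition F (s k) (s (k + 1))) :
    (fun k => (s k).1 ⟨0, hd⟩) ∈ sft (F : Set (Pattern A)) := by
  have hsucc : ∀ k (i : ℕ) (hi : i + 1 < diam F),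
      (s k).1 ⟨i + 1, hi⟩ = (s (k + 1)).1 ⟨i, by omega⟩ := by
    intro k i hi
    obtain ⟨x, -, h1, h2⟩ := hs k
    rw [h1, h2]
    rfl
  have hread : ∀ (i : ℕ) (hi : i < diam F) k, (s k).1 ⟨i, hi⟩ = (s (k + i)).1 ⟨0, hd⟩ := by
    intro i
    induction i with
    | zero => intro hi k; simp
    | succ i ih =>
      intro hi k
      rw [hsucc, ih]
      push_cast
      ring_nf
  intro w hw k h
  -- The admissible word of length `d(F) + 1` starting at the leftmost cell of the translated window
  -- contains the whole translate.
  obtain ⟨x, hx, h1, h2⟩ := hs (k + w.window.min' w.nonempty)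
  refine hx w hw ⟨-w.window.min' w.nonempty, fun i => ?_⟩
  obtain ⟨hi1, hi2⟩ := sub_le_diam hw i.2
  refine ⟨⟨((i : ℤ) - w.window.min' w.nonempty).toNat, by omega⟩, ?_, ?_⟩
  · simp only
    omega
  · rw [← congrFun h i]
    simp only [shift]
    generalize_proofs _ hj'
    revert hj'
    generalize hj : ((i : ℤ) - w.window.min' w.nonempty).toNat = j
    intro hj'
    have hij : k + (i : ℤ) = k + w.window.min' w.nonempty + j := by omega
    rw [hij]
    -- Letter `0` of the transition word is read in its source state, every later letter in its
    -- target state.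
    rcases Nat.eq_zero_or_pos j with rfl | hjpos
    · rw [Nat.cast_zero, add_zero, h1]; rfl
    · obtain ⟨j, rfl⟩ := Nat.exists_eq_add_of_lt hjpos
      have hlt : j < diam F := by omega
      rw [show k + w.window.min' w.nonempty + ((0 + j + 1 : ℕ) : ℤ)
        = k + w.window.min' w.nonempty + 1 + j by push_cast; ring, ← hread j hlt, h2]
      congr 1
      ext
      simp

theorem exists_periodic_mem_sft (hd : 0 < diam F) (hirr : Irreducible F) :
    ∃ z ∈ sft (F : Set (Pattern A)), ∃ n : ℕ, 0 < n ∧ ∀ k : ℤ, z (k + n) = z k := by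
  obtain ⟨u, ⟨hu, -⟩, -⟩ := hirr.exists_communicate
  obtain ⟨n, hn, hw⟩ := exists_walk_of_transGen hu
  obtain ⟨c, h0, h1, hc⟩ := hw.exists_seq
  have hn' : (0 : ℤ) < n := by exact_mod_cast hn
  refine ⟨_, mem_sft_of_path hd (fun k => c (k % n).toNat) fun k => ?_, n, hn, fun k => by simp⟩
  have hk0 := Int.emod_nonneg k hn'.ne'
  have hk1 := Int.emod_lt_of_pos k hn'
  have key := hc (k % n).toNat (by omega)
  convert key using 1
  rw [← Int.emod_add_emod]
  by_cases hlast : k % n + 1 = n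
  · rw [hlast, Int.emod_self, show (k % n).toNat + 1 = n by omega, h1, Int.toNat_zero, h0]
  · rw [Int.emod_eq_of_lt (by omega) (by omega)]
    congr 1
    omega

end

section

/-! ### Shifts and ergodicity of product measures -/

theorem shift_shift {A : Type*} (k l : ℤ) (x : ℤ → A) : shift k (shift l x) = shift (l + k) x := by
  funext i
  simp [shift, add_assoc]

@[simp]
theorem shift_zero {A : Type*} (x : ℤ → A) : shift 0 x = x := by
  funext i
  simp [shift]

theorem iterate_shift {A : Type*} (k : ℤ) (n : ℕ) :
    (shift k)^[n] = (shift (n * k) : (ℤ → A) → ℤ → A) := by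
  induction n with
  | zero => funext x; simp
  | succ n ih =>
    rw [Function.iterate_succ', ih]
    funext x
    rw [Function.comp_apply, shift_shift]
    push_cast
    ring_nf

variable {A : Type*} [MeasurableSpace A]

@[fun_prop]
theorem measurable_shift (k : ℤ) : Measurable (shift k : (ℤ → A) → ℤ → A) :=
  measurable_pi_lambda _ fun l => measurable_pi_apply (k + l)

theorem measurePreserving_shift {μ : Measure (ℤ → A)} (hμ : μ ∈ invariantMeasures A) (k : ℤ) :
    MeasurePreserving (shift k) μ μ :=
  ⟨measurable_shift k, hμ.2 k⟩

theorem infinitePi_mem_invariantMeasures (ρ : Measure A) [IsProbabilityMeasure ρ] :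
    Measure.infinitePi (fun _ : ℤ => ρ) ∈ invariantMeasures A := by
  refine ⟨inferInstance, fun k => ?_⟩
  have h := Measure.infinitePi_map_piCongrLeft (fun _ : ℤ => ρ) (Equiv.addLeft (-k))
  convert h using 2
  funext x l
  rw [MeasurableEquiv.coe_piCongrLeft]
  have := Equiv.piCongrLeft_apply_apply (fun _ : ℤ => A) (Equiv.addLeft (-k)) x (k + l)
  simp only [Equiv.coe_addLeft, neg_add_cancel_left] at this
  rw [this, shift]

/-- Events depending on disjoint sets of cells are independent under a product measure. -/
theorem infinitePi_cylinder_inter (ρ : Measure A) [IsProbabilityMeasure ρ] {I : Finset ℤ}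
    {B : Set (I → A)} (hB : MeasurableSet B) {k : ℤ} (hk : ∀ i ∈ I, ∀ j ∈ I, k + i ≠ j) :
    Measure.infinitePi (fun _ : ℤ => ρ) (cylinder I B ∩ shift k ⁻¹' cylinder I B) =
      Measure.infinitePi (fun _ : ℤ => ρ) (cylinder I B) *
      Measure.infinitePi (fun _ : ℤ => ρ) (shift k ⁻¹' cylinder I B) := by
  have hind : iIndepFun (fun (i : ℤ) (ω : ℤ → A) => ω i) (Measure.infinitePi (fun _ : ℤ => ρ)) :=
    iIndepFun_infinitePi (X := fun _ ω => ω) (by fun_prop)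
  have hdisj : Disjoint I (I.image (k + ·)) := by
    rw [Finset.disjoint_left]
    intro j hj hj'
    obtain ⟨i, hi, rfl⟩ := Finset.mem_image.1 hj'
    exact hk i hi _ hj rfl
  have h := hind.indepFun_finset I (I.image (k + ·)) hdisj (fun i => measurable_pi_apply i)
  let r : (I.image (k + ·) → A) → (I → A) :=
    fun g i => g ⟨k + i, Finset.mem_image_of_mem _ i.2⟩
  have hr : Measurable r := measurable_pi_lambda _ fun i => measurable_pi_apply _
  exact h.measure_inter_preimage_eq_mul _ _ hB (hr hB)

/-- Approximate an invariant `S` by a cylinder `C` and translate `C` by a multiple of `n` onto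
disjoint cells: the translate also approximates `S` and is independent of `C`, so `μ(S) = μ(S)²`.
All powers of the shift are treated because phases are invariant only under the `p`-th one. -/
theorem ergodic_shift_infinitePi (ρ : Measure A) [IsProbabilityMeasure ρ] {n : ℕ} (hn : 0 < n) :
    Ergodic (shift (n : ℤ)) (Measure.infinitePi (fun _ : ℤ => ρ)) := by
  set μ := Measure.infinitePi (fun _ : ℤ => ρ) with hμ
  have hinv := infinitePi_mem_invariantMeasures ρ
  rw [← hμ] at hinv
  refine ⟨measurePreserving_shift hinv n, ⟨fun S hS hSn => ?_⟩⟩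
  have hdense : μ.MeasureDense (measurableCylinders fun _ : ℤ => A) :=
    .of_generateFrom_isSetAlgebra_finite μ isSetAlgebra_measurableCylinders
      generateFrom_measurableCylinders.symm
  -- Replacing `S` by `C ∩ C'` costs `2ε`; replacing `μ(C)²` by `μ(S)²` costs another `2ε`.
  have key : ∀ ε : ℝ, 0 < ε → |μ.real S - μ.real S * μ.real S| ≤ 4 * ε := by
    intro ε hε
    obtain ⟨C, hC, hSC⟩ := hdense.approx S hS (measure_ne_top _ _) ε hε
    obtain ⟨I, B, hB, rfl⟩ := (mem_measurableCylinders _).1 hC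
    obtain ⟨m, hm⟩ : ∃ m : ℕ, ∀ i ∈ I, ∀ j ∈ I, ((m * n : ℕ) : ℤ) + i ≠ j := by
      obtain ⟨M, hM⟩ := ((I ×ˢ I).image fun q : ℤ × ℤ => q.2 - q.1).exists_le
      refine ⟨M.toNat + 1, fun i hi j hj h => ?_⟩
      have h1 := hM (j - i) (Finset.mem_image.2 ⟨(i, j), Finset.mk_mem_product hi hj, rfl⟩)
      have h2 : M.toNat + 1 ≤ (M.toNat + 1) * n := Nat.le_mul_of_pos_right _ hn
      omega
    set C := cylinder (α := fun _ : ℤ => A) I B with hCdef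
    set C' := shift ((m * n : ℕ) : ℤ) ⁻¹' C
    have hCm : MeasurableSet C := hB.cylinder I
    have hS' : shift ((m * n : ℕ) : ℤ) ⁻¹' S = S := by
      have := Function.IsFixedPt.preimage_iterate hSn m
      rw [iterate_shift] at this
      push_cast
      exact this
    have h1 : μ.real (symmDiff S C) ≤ ε := ENNReal.toReal_le_of_le_ofReal hε.le hSC.le
    have h2 : μ.real (symmDiff S C') ≤ ε := by
      refine le_trans (le_of_eq ?_) h1
      rw [measureReal_def, measureReal_def, ← (measurePreserving_shift hinv ((m * n : ℕ) : ℤ)).measure_preimage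
        (hS.symmDiff hCm).nullMeasurableSet, Set.preimage_symmDiff, hS']
    have h3 : μ.real (C ∩ C') = μ.real C * μ.real C := by
      have := infinitePi_cylinder_inter ρ hB hm
      rw [← hμ, (measurePreserving_shift hinv _).measure_preimage hCm.nullMeasurableSet] at this
      rw [measureReal_def, this, ENNReal.toReal_mul, measureReal_def]
    have h4 : |μ.real S - μ.real (C ∩ C')| ≤ 2 * ε := by
      refine (abs_measureReal_sub_le_measureReal_symmDiff hS.nullMeasurableSet
        (hCm.inter (measurable_shift _ hCm)).nullMeasurableSet).trans ?_
      calc μ.real (symmDiff S (C ∩ C')) ≤ μ.real (symmDiff S C ∪ symmDiff S C') := by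
            refine measureReal_mono ?_
            intro x
            simp only [Set.mem_symmDiff, Set.mem_inter_iff, Set.mem_union]
            tauto
        _ ≤ _ := (measureReal_union_le _ _).trans (by linarith)
    have h5 : |μ.real S - μ.real C| ≤ ε :=
      (abs_measureReal_sub_le_measureReal_symmDiff hS.nullMeasurableSet
        hCm.nullMeasurableSet).trans h1
    rw [h3] at h4
    have hS0 : 0 ≤ μ.real S := measureReal_nonneg
    have hS1 : μ.real S ≤ 1 := measureReal_le_one
    have hC0 : 0 ≤ μ.real C := measureReal_nonneg
    have hC1 : μ.real C ≤ 1 := measureReal_le_one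
    rw [abs_le] at *
    constructor <;> nlinarith
  have hprod : μ.real S - μ.real S * μ.real S = 0 := by
    rw [← abs_nonpos_iff]
    refine le_of_forall_pos_le_add fun ε hε => ?_
    have := key (ε / 4) (by positivity)
    linarith
  rw [eventuallyConst_set']
  have : μ.real S * (1 - μ.real S) = 0 := by linarith
  rcases mul_eq_zero.1 this with h | h
  · left
    rw [ae_eq_empty]
    exact (measureReal_eq_zero_iff).1 h
  · right
    rw [ae_eq_univ, prob_compl_eq_zero_iff hS, ← ENNReal.toReal_eq_one_iff, ← measureReal_def]
    linarith

end

section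

/-! ### A noisy measure that forgets the phase -/

@[fun_prop]
theorem measurable_proj₁ {A B : Type*} [MeasurableSpace A] [MeasurableSpace B] :
    Measurable (proj₁ : (ℤ → A × B) → ℤ → A) :=
  measurable_pi_lambda _ fun k => (measurable_pi_apply k).fst

@[fun_prop]
theorem measurable_proj₂ {A B : Type*} [MeasurableSpace A] [MeasurableSpace B] :
    Measurable (proj₂ : (ℤ → A × B) → ℤ → B) :=
  measurable_pi_lambda _ fun k => (measurable_pi_apply k).snd

theorem map_mem_invariantMeasures {A B : Type*} [MeasurableSpace A] [MeasurableSpace B]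
    {μ : Measure (ℤ → A)} (hμ : μ ∈ invariantMeasures A) {f : (ℤ → A) → ℤ → B}
    (hf : Measurable f) (hcomm : ∀ k x, f (shift k x) = shift k (f x)) :
    μ.map f ∈ invariantMeasures B := by
  have := hμ.1
  refine ⟨Measure.isProbabilityMeasure_map hf.aemeasurable, fun k => ?_⟩
  rw [Measure.map_map (measurable_shift k) hf,
    show shift k ∘ f = f ∘ shift k from funext fun x => (hcomm k x).symm,
    ← Measure.map_map hf (measurable_shift k), hμ.2 k]

/-- The `d` consecutive cells ending at `j` are all obscured. -/
def IsRunEnd (d : ℕ) (b : ℤ → Bool) (j : ℤ) : Prop :=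
  ∀ i : ℕ, i < d → b (j - i) = true

/-- The distance from `k` to the last end of an obscured run of length `d` weakly before `k`. -/
def sinceRun (d : ℕ) (b : ℤ → Bool) (k : ℤ) : ℕ :=
  sInf {t : ℕ | IsRunEnd d b (k - t)}

/-- Given the noise `b`, start reading the configuration `z` afresh at the end of each obscured
run of length `d`. -/
def restart {A : Type*} (d : ℕ) (z : ℤ → A) (b : ℤ → Bool) : ℤ → A × Bool :=
  fun k => (z (sinceRun d b k), b k)

theorem isRunEnd_shift (d : ℕ) (b : ℤ → Bool) (k j : ℤ) :
    IsRunEnd d (shift k b) j ↔ IsRunEnd d b (k + j) := by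
  simp [IsRunEnd, shift, add_sub_assoc]

theorem restart_shift {A : Type*} (d : ℕ) (z : ℤ → A) (k : ℤ) (b : ℤ → Bool) :
    restart d z (shift k b) = shift k (restart d z b) := by
  funext j
  simp only [restart, sinceRun, isRunEnd_shift, shift, add_sub_assoc]

theorem measurableSet_isRunEnd (d : ℕ) (j : ℤ) : MeasurableSet {b | IsRunEnd d b j} := by
  have : {b | IsRunEnd d b j} = ⋂ i : ℕ, ⋂ _ : i < d, (fun b : ℤ → Bool => b (j - i)) ⁻¹' {true} := by
    ext b
    simp [IsRunEnd]
  rw [this]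
  exact .iInter fun i => .iInter fun _ => measurable_pi_apply (j - (i : ℤ)) (.singleton true)

theorem measurable_sinceRun (d : ℕ) (k : ℤ) : Measurable fun b => sinceRun d b k := by
  classical
  -- The second alternative makes the search succeed at `0` when there is no run, matching `sInf ∅ =
  -- 0`.
  let q : (ℤ → Bool) → ℕ → Prop := fun b t =>
    IsRunEnd d b (k - t) ∨ ∀ s : ℕ, ¬ IsRunEnd d b (k - s)
  have hq : ∀ b, ∃ t, q b t := by
    intro b
    by_cases h : ∃ t : ℕ, IsRunEnd d b (k - t)
    · exact h.imp fun t ht => .inl ht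
    · exact ⟨0, .inr (not_exists.1 h)⟩
  have hm : ∀ t : ℕ, MeasurableSet {b | q b t} := by
    intro t
    refine (measurableSet_isRunEnd d _).union ?_
    have : {b | ∀ s : ℕ, ¬ IsRunEnd d b (k - s)} = ⋂ s : ℕ, {b | IsRunEnd d b (k - s)}ᶜ := by
      ext b
      simp
    change MeasurableSet {b | ∀ s : ℕ, ¬ IsRunEnd d b (k - s)}
    rw [this]
    exact .iInter fun s => (measurableSet_isRunEnd d _).compl
  convert measurable_find hq hm using 2 with b
  by_cases h : ∃ t : ℕ, IsRunEnd d b (k - t)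
  · refine (Nat.sInf_def (s := {t : ℕ | IsRunEnd d b (k - t)}) h).trans ?_
    refine Nat.find_congr' fun {t} => ?_
    simp only [Set.mem_ofPred_eq, q]
    exact ⟨.inl, fun h' => h'.resolve_right (not_forall_not.2 h)⟩
  · have h0 : {t : ℕ | IsRunEnd d b (k - t)} = ∅ := by
      ext t
      simpa using fun ht => h ⟨t, ht⟩
    rw [sinceRun, h0, Nat.sInf_empty, eq_comm, Nat.find_eq_zero]
    exact .inr (not_exists.1 h)

theorem measurable_restart {A : Type*} [MeasurableSpace A] (d : ℕ) (z : ℤ → A) :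
    Measurable (restart d z) := by
  refine measurable_pi_lambda _ fun k => ?_
  exact ((measurable_of_countable fun t : ℕ => z t).comp (measurable_sinceRun d k)).prodMk
    (measurable_pi_apply k)

theorem isRunEnd_sinceRun {d : ℕ} {b : ℤ → Bool} {k : ℤ} (h : ∃ t : ℕ, IsRunEnd d b (k - t)) :
    IsRunEnd d b (k - sinceRun d b k) :=
  Nat.sInf_mem (s := {t : ℕ | IsRunEnd d b (k - t)}) h

/-- With no run ending in `(k, l]`, the last run end before `l` is the one before `k`. -/
theorem sinceRun_eq {d : ℕ} {b : ℤ → Bool} {k l : ℤ} (hkl : k ≤ l)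
    (h : ∃ t : ℕ, IsRunEnd d b (k - t)) (hrun : ∀ j, k < j → j ≤ l → ¬ IsRunEnd d b j) :
    (sinceRun d b l : ℤ) = sinceRun d b k + (l - k) := by
  have hk := isRunEnd_sinceRun h
  have hl : IsRunEnd d b (l - (sinceRun d b k + (l - k).toNat : ℕ)) := by
    convert hk using 1
    push_cast
    omega
  have hle : sinceRun d b l ≤ sinceRun d b k + (l - k).toNat := Nat.sInf_le hl
  have hl' := isRunEnd_sinceRun (b := b) (k := l) ⟨_, hl⟩
  have hlk : l - sinceRun d b l ≤ k := by
    by_contra! hlt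
    exact hrun _ hlt (by omega) hl'
  have hge : sinceRun d b k ≤ (k - (l - sinceRun d b l)).toNat := by
    refine Nat.sInf_le ?_
    rw [Set.mem_ofPred_eq]
    convert hl' using 1
    omega
  omega

/-- If there are obscured runs of length `d(F)` arbitrarily far to the left, restarting a
configuration of the subshift at each of them creates no clear forbidden pattern. -/
theorem restart_mem_sft {A : Type*} {F : Finset (Pattern A)} {z : ℤ → A}
    (hz : z ∈ sft (F : Set (Pattern A))) {b : ℤ → Bool}
    (hb : ∀ k : ℤ, ∃ t : ℕ, IsRunEnd (diam F) b (k - t)) :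
    restart (diam F) z b ∈ sft (Pattern.clear '' (F : Set (Pattern A))) := by
  rintro _ ⟨w, hw, rfl⟩ k h
  have hmem : ∀ i ∈ w.window, b (k + i) = false := fun i hi =>
    congrArg Prod.snd (congrFun h ⟨i, hi⟩)
  have hlet : ∀ i : w.window, z (sinceRun (diam F) b (k + i)) = w.letter i := fun i =>
    congrArg Prod.fst (congrFun h i)
  set m := w.window.min' w.nonempty with hm
  have hm0 := hmem m (w.window.min'_mem w.nonempty)
  -- A clear occurrence of `w` would be read inside `z`, its leftmost cell landing at the counter's
  -- value at `k + m`.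
  refine hz w hw (sinceRun (diam F) b (k + m) - m) (funext fun i => ?_)
  obtain ⟨hi1, hi2⟩ := sub_le_diam hw i.2
  rw [← hm] at hi1 hi2
  rw [← hlet i, shift]
  congr 1
  rw [sinceRun_eq (k := k + m) (l := k + i) (by omega) (hb _)]
  · ring
  · intro j hj1 hj2 hj
    -- A run ending at the clear cell `k + i` is impossible; one ending earlier, at most `d(F) - 1`
    -- cells after `k + m`, would cover the clear cell `k + m`.
    rcases eq_or_lt_of_le hj2 with rfl | hlt
    · have := hj 0 (by omega)
      rw [Nat.cast_zero, sub_zero, hmem i i.2] at this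
      exact absurd this (by simp)
    · have := hj (j - (k + m)).toNat (by omega)
      rw [show j - ((j - (k + m)).toNat : ℤ) = k + m by omega, hm0] at this
      exact absurd this (by simp)

/-- The event for a given `k` is contained in its preimage under the shift, so it is null or full by
ergodicity; the case `t = 0` already has positive probability. -/
theorem ae_exists_isRunEnd (d : ℕ) {ρ : Measure Bool} [IsProbabilityMeasure ρ]
    (hρ : ρ {true} ≠ 0) :
    ∀ᵐ b ∂Measure.infinitePi (fun _ : ℤ => ρ), ∀ k : ℤ, ∃ t : ℕ, IsRunEnd d b (k - t) := by
  set P := Measure.infinitePi (fun _ : ℤ => ρ) with hP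
  rw [ae_all_iff]
  intro k
  have hm : MeasurableSet {b | ∃ t : ℕ, IsRunEnd d b (k - t)} := by
    have : {b | ∃ t : ℕ, IsRunEnd d b (k - t)} = ⋃ t : ℕ, {b | IsRunEnd d b (k - t)} := by
      ext b
      simp
    exact this ▸ .iUnion fun t => measurableSet_isRunEnd d _
  have hmono : {b | ∃ t : ℕ, IsRunEnd d b (k - t)} ⊆
      shift ((1 : ℕ) : ℤ) ⁻¹' {b | ∃ t : ℕ, IsRunEnd d b (k - t)} := by
    rintro b ⟨t, ht⟩
    refine ⟨t + 1, ?_⟩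
    rw [isRunEnd_shift]
    convert ht using 1
    push_cast
    ring
  rcases (ergodic_shift_infinitePi ρ one_pos).ae_empty_or_univ_of_ae_le_preimage
    hm.nullMeasurableSet hmono.eventuallyLE with h | h
  · exfalso
    rw [ae_eq_empty, ← hP] at h
    have hsub : Set.pi ((Finset.range d).image fun i : ℕ => k - (i : ℤ) : Finset ℤ)
        (fun _ => ({true} : Set Bool)) ⊆ {b | ∃ t : ℕ, IsRunEnd d b (k - t)} := by
      intro b hb
      refine ⟨0, fun i hi => ?_⟩
      have := hb (k - i) (by simpa using hi)
      simpa using this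
    have h0 := measure_mono_null hsub h
    rw [hP, Measure.infinitePi_pi _ (fun _ _ => .singleton _)] at h0
    obtain ⟨_, _, h1⟩ := Finset.prod_eq_zero_iff.1 h0
    exact hρ h1
  · rw [ae_eq_univ] at h
    exact h

theorem measurableSet_sft {A : Type*} [MeasurableSpace A] [MeasurableSingletonClass A]
    {F : Set (Pattern A)} (hF : F.Countable) : MeasurableSet (sft F) := by
  have : sft F = ⋂ w ∈ F, ⋂ k : ℤ, ((fun x (i : w.window) => shift k x i) ⁻¹' {w.letter})ᶜ := by
    ext x
    simp [sft]
  rw [this]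
  refine .biInter hF fun w _ => .iInter fun k => MeasurableSet.compl ?_
  have hm : Measurable fun (x : ℤ → A) (i : w.window) => shift k x i :=
    measurable_pi_lambda _ fun i => measurable_pi_apply (k + (i : ℤ))
  exact hm (.singleton _)

theorem restart_mem_noisyMeasuresLift {A : Type*} [MeasurableSpace A]
    [MeasurableSingletonClass A] {F : Finset (Pattern A)}
    {z : ℤ → A} (hz : z ∈ sft (F : Set (Pattern A))) {δ : unitInterval} (hδ : 0 < δ) {ε : ℝ}
    (hδε : (δ : ℝ) ≤ ε) :
    (Measure.infinitePi (fun _ : ℤ => bernoulliMeasure true false δ)).map (restart (diam F) z) ∈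
      noisyMeasuresLift F bernoulliNoises ε := by
  have hinv := infinitePi_mem_invariantMeasures (bernoulliMeasure true false δ)
  have hmeas := measurable_restart (diam F) z
  have hproj : ((Measure.infinitePi (fun _ : ℤ => bernoulliMeasure true false δ)).map
      (restart (diam F) z)).map proj₂ =
      Measure.infinitePi (fun _ : ℤ => bernoulliMeasure true false δ) := by
    rw [Measure.map_map measurable_proj₂ hmeas]
    exact Measure.map_id
  have htrue : bernoulliMeasure true false δ {true} = unitInterval.toNNReal δ := by
    simp
  refine ⟨⟨map_mem_invariantMeasures hinv hmeas (restart_shift _ z), ?_⟩, ?_, ?_⟩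
  · refine (ae_map_iff hmeas.aemeasurable
      (measurableSet_sft (F.finite_toSet.image _).countable)).2 ?_
    filter_upwards [ae_exists_isRunEnd (diam F) (ρ := bernoulliMeasure true false δ)
      (by
        rw [htrue, ENNReal.coe_ne_zero]
        exact fun h => hδ.ne' (Subtype.ext (congrArg NNReal.toReal h)))] with b hb
    exact restart_mem_sft hz hb
  · rw [hproj]
    exact ⟨δ, rfl⟩
  · rw [hproj]
    refine ⟨hinv, le_of_eq_of_le ?_ hδε⟩
    have h1 := (measurePreserving_eval_infinitePi
      (fun _ : ℤ => bernoulliMeasure true false δ) 0).measure_preimage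
      (MeasurableSet.singleton true).nullMeasurableSet
    rw [htrue] at h1
    rw [measureReal_def]
    exact (congrArg ENNReal.toReal h1).trans (by simp)

end

section

/-! ### Lower bound on the Besicovitch distance -/

/-- Almost invariant events are independent of ergodic factors. -/
theorem measure_preimage_inter_of_ergodic_factor {X Y : Type*} [MeasurableSpace X]
    [MeasurableSpace Y] {l : Measure X} {μ : Measure Y} [IsFiniteMeasure l]
    [IsProbabilityMeasure μ] {S : X → X} {T : Y → Y} {π : X → Y} (hS : MeasurePreserving S l l)
    (hT : Ergodic T μ) (hπ : MeasurePreserving π l μ) (hcomm : Function.Semiconj π S T)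
    {E : Set X} (hE : MeasurableSet E) (hinv : S ⁻¹' E =ᵐ[l] E) {B : Set Y}
    (hB : MeasurableSet B) : l (π ⁻¹' B ∩ E) = l E * μ B := by
  have hSE : MeasurePreserving S (l.restrict E) (l.restrict E) := by
    have := hS.restrict_preimage hE
    rwa [Measure.restrict_congr_set hinv] at this
  have hmp : MeasurePreserving π (l.restrict E) ((l.restrict E).map π) := ⟨hπ.measurable, rfl⟩
  have hTκ := hmp.of_semiconj hSE hcomm hT.measurable
  have hac : (l.restrict E).map π ≪ μ := by
    rw [← hπ.map_eq]
    exact Measure.absolutelyContinuous_of_le Measure.restrict_le_self |>.map hπ.measurable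
  -- The image of `l` restricted to `E` is `T`-invariant and absolutely continuous with respect to
  -- the ergodic `μ`, hence a multiple of `μ`; total mass identifies the factor.
  obtain ⟨c, hc⟩ := hT.eq_smul_of_absolutelyContinuous hTκ hac
  have happ : ∀ {C : Set Y}, MeasurableSet C → l (π ⁻¹' C ∩ E) = c * μ C := by
    intro C hC
    rw [← Measure.restrict_apply (hπ.measurable hC), ← Measure.map_apply hπ.measurable hC, hc]
    simp
  have huniv := happ MeasurableSet.univ
  rw [Set.preimage_univ, Set.univ_inter, measure_univ, mul_one] at huniv
  rw [happ hB, huniv]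

open Classical in
theorem hammingDist_eq_sum {A : Type*} (I : Finset ℤ) (x y : ℤ → A) :
    hammingDist I x y = (∑ k ∈ I, if x k ≠ y k then 1 else 0) / (I.card : ℝ) := by
  rw [hammingDist, Finset.card_filter]
  push_cast
  rfl

theorem hammingDist_nonneg {A : Type*} (I : Finset ℤ) (x y : ℤ → A) : 0 ≤ hammingDist I x y := by
  rw [hammingDist]
  positivity

theorem hammingDist_le_one {A : Type*} (I : Finset ℤ) (x y : ℤ → A) : hammingDist I x y ≤ 1 := by
  classical
  exact div_le_one_of_le₀ (Nat.cast_le.2 (Finset.card_filter_le _ _)) (by positivity)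

variable {A : Type*} [MeasurableSpace A]

/-- The product coupling. Nonemptiness matters because the real `sInf ∅ = 0` would defeat a lower
bound on `dB`. -/
theorem couplings_nonempty {μ ν : Measure (ℤ → A)} (hμ : μ ∈ invariantMeasures A)
    (hν : ν ∈ invariantMeasures A) : (couplings μ ν).Nonempty := by
  have := hμ.1
  have := hν.1
  let g : (ℤ → A) × (ℤ → A) → ℤ → A × A := fun q k => (q.1 k, q.2 k)
  have hg : Measurable g := by fun_prop
  refine ⟨(μ.prod ν).map g, ⟨Measure.isProbabilityMeasure_map hg.aemeasurable, fun k => ?_⟩, ?_, ?_⟩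
  · rw [Measure.map_map (measurable_shift k) hg]
    change Measure.map (g ∘ Prod.map (shift k) (shift k)) _ = _
    rw [← Measure.map_map hg (by fun_prop),
      ((measurePreserving_shift hμ k).prod (measurePreserving_shift hν k)).map_eq]
  · rw [Measure.map_map measurable_proj₁ hg]
    exact Measure.fst_prod
  · rw [Measure.map_map measurable_proj₂ hg]
    exact Measure.snd_prod

theorem mem_invariantMeasures_of_map_shift_one {μ : Measure (ℤ → A)} [IsProbabilityMeasure μ]
    (h : μ.map (shift 1) = μ) : μ ∈ invariantMeasures A := by
  have hnat : ∀ n : ℕ, μ.map (shift (n : ℤ)) = μ := by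
    intro n
    have := (MeasurePreserving.mk (measurable_shift 1) h).iterate n
    rw [iterate_shift, mul_one] at this
    exact this.map_eq
  refine ⟨inferInstance, fun k => ?_⟩
  obtain ⟨n, rfl | rfl⟩ := k.eq_nat_or_neg
  · exact hnat n
  · conv_lhs => rw [← hnat n]
    rw [Measure.map_map (measurable_shift _) (measurable_shift _),
      show (shift (-(n : ℤ)) : (ℤ → A) → ℤ → A) ∘ shift n = id from
        funext fun x => by simp [shift_shift], Measure.map_id]

section Discrete

variable [Finite A] [DiscreteMeasurableSpace A]

/-! ### Average frequency of mismatches under a coupling -/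

theorem measurableSet_ne (k : ℤ) : MeasurableSet {z : ℤ → A × A | (z k).1 ≠ (z k).2} :=
  (measurable_pi_apply k : Measurable fun z : ℤ → A × A => z k)
    (MeasurableSet.of_discrete (s := {q : A × A | q.1 ≠ q.2}))

theorem measurable_hammingDist (I : Finset ℤ) :
    Measurable fun z : ℤ → A × A => hammingDist I (proj₁ z) (proj₂ z) := by
  classical
  simp only [hammingDist_eq_sum]
  exact (Finset.measurable_sum _ fun k _ =>
    Measurable.ite (measurableSet_ne k) measurable_const measurable_const).div_const _

theorem integral_hammingDist {l : Measure (ℤ → A × A)} (hl : l ∈ invariantMeasures (A × A))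
    {I : Finset ℤ} (hI : I.Nonempty) :
    ∫ z, hammingDist I (proj₁ z) (proj₂ z) ∂l = l.real {z | (z 0).1 ≠ (z 0).2} := by
  classical
  have := hl.1
  have hk : ∀ k : ℤ, (fun z : ℤ → A × A => if proj₁ z k ≠ proj₂ z k then (1 : ℝ) else 0) =
      Set.indicator {z | (z k).1 ≠ (z k).2} (fun _ => 1) := by
    intro k
    funext z
    by_cases h : (z k).1 = (z k).2 <;> simp [Set.indicator, proj₁, proj₂, h]
  have hinv : ∀ k : ℤ, l.real {z | (z k).1 ≠ (z k).2} = l.real {z | (z 0).1 ≠ (z 0).2} := by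
    intro k
    rw [measureReal_def, measureReal_def,
      ← (measurePreserving_shift hl k).measure_preimage (measurableSet_ne 0).nullMeasurableSet]
    simp [shift]
  simp only [hammingDist_eq_sum]
  rw [integral_div, integral_finsetSum]
  · simp_rw [fun k => congrArg (fun f => ∫ z, f z ∂l) (hk k)]
    simp_rw [fun k => integral_indicator_const (μ := l) (1 : ℝ) (measurableSet_ne (A := A) k), hinv]
    have : (I.card : ℝ) ≠ 0 := by exact_mod_cast hI.card_pos.ne'
    simp [this]
  · intro k _
    rw [hk]
    exact (integrable_const 1).indicator (measurableSet_ne k)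

/-- Every window average has integral `l(z₀.1 ≠ z₀.2)` by invariance; reverse Fatou, with dominating
function `1`, passes to the limsup. -/
theorem le_integral_dH {l : Measure (ℤ → A × A)} (hl : l ∈ invariantMeasures (A × A)) :
    l.real {z | (z 0).1 ≠ (z 0).2} ≤ ∫ z, dH (proj₁ z) (proj₂ z) ∂l := by
  have := hl.1
  set q := l.real {z : ℤ → A × A | (z 0).1 ≠ (z 0).2}
  let h : ℕ → (ℤ → A × A) → ℝ := fun n z =>
    hammingDist (Finset.Icc (-(n : ℤ)) (n : ℤ)) (proj₁ z) (proj₂ z)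
  have hm : ∀ n, Measurable (h n) := fun n => measurable_hammingDist _
  have h0 : ∀ n z, 0 ≤ h n z := fun n z => hammingDist_nonneg _ _ _
  have h1 : ∀ n z, h n z ≤ 1 := fun n z => hammingDist_le_one _ _ _
  have hcob : ∀ z, IsCoboundedUnder (· ≤ ·) atTop (fun n => h n z) := fun z =>
    (isBoundedUnder_of ⟨0, fun n => h0 n z⟩ : IsBoundedUnder (· ≥ ·) _ _).isCoboundedUnder_le
  have hbdd : ∀ z, IsBoundedUnder (· ≤ ·) atTop (fun n => h n z) := fun z =>
    isBoundedUnder_of ⟨1, fun n => h1 n z⟩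
  have hd0 : ∀ z : ℤ → A × A, 0 ≤ dH (proj₁ z) (proj₂ z) := fun z =>
    le_limsup_of_frequently_le (Eventually.of_forall fun n => h0 n z).frequently (hbdd z)
  have hdm : Measurable fun z : ℤ → A × A => dH (proj₁ z) (proj₂ z) := Measurable.limsup hm
  have hint : ∀ n, ∫⁻ z, ENNReal.ofReal (h n z) ∂l = ENNReal.ofReal q := by
    intro n
    rw [← ofReal_integral_eq_lintegral_ofReal, integral_hammingDist hl]
    · simp
    · exact .of_bound (hm n).aestronglyMeasurable 1 (.of_forall fun z => by
        rw [Real.norm_of_nonneg (h0 n z)]; exact h1 n z)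
    · exact .of_forall (h0 n)
  have hF := limsup_lintegral_le (μ := l) (f := fun n z => ENNReal.ofReal (h n z)) (fun _ => 1)
    (fun n => (hm n).ennreal_ofReal)
    (fun n => .of_forall fun z => ENNReal.ofReal_le_one.2 (h1 n z)) (by simp)
  simp only [hint, limsup_const] at hF
  rw [lintegral_congr fun z => (ENNReal.ofReal_limsup (hcob z) (hbdd z)).symm] at hF
  rw [integral_eq_lintegral_of_nonneg_ae (.of_forall hd0) hdm.aestronglyMeasurable]
  refine (ENNReal.ofReal_le_iff_le_toReal ?_).1 hF
  refine ne_top_of_le_ne_top ENNReal.one_ne_top ?_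
  calc _ ≤ ∫⁻ _, 1 ∂l := lintegral_mono fun z => ENNReal.ofReal_le_one.2 <|
        limsup_le_of_le (hcob z) (.of_forall fun n => h1 n z)
    _ = 1 := by simp

/-! ### Phases in couplings with measures on the SFT -/

theorem measurableSet_window (d : ℕ) (S : Set (Fin d → A)) :
    MeasurableSet {x : ℤ → A | (fun i : Fin d => x i) ∈ S} :=
  (measurable_pi_lambda (fun (x : ℤ → A) (i : Fin d) => x i) fun i => measurable_pi_apply (i : ℤ))
    (MeasurableSet.of_discrete (s := S))

variable {F : Finset (Pattern A)} {p : ℕ} [NeZero p] {φ : (Fin (diam F) → A) → ZMod p}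

/-- The shift permutes the `p` phase events cyclically, up to null sets, and they partition the
space. -/
theorem measureReal_phase_eq
    (hφ : ∀ y ∈ sft (F : Set (Pattern A)), ∀ k : ℤ,
      φ (fun i => y (k + i)) = φ (fun i => y i) + k)
    {ν : Measure (ℤ → A)} (hν : ν ∈ sftMeasures (F : Set (Pattern A))) (c : ZMod p) :
    ν.real ((fun y => φ fun i => y i) ⁻¹' {c}) = 1 / p := by
  have := hν.1.1
  have hm : ∀ c : ZMod p, MeasurableSet ((fun y : ℤ → A => φ fun i => y i) ⁻¹' {c}) :=
    fun c => measurableSet_window _ (φ ⁻¹' {c})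
  have h0 : ∀ c, ν.real ((fun y => φ fun i => y i) ⁻¹' {c}) =
      ν.real ((fun y => φ fun i => y i) ⁻¹' {0}) := by
    intro c
    rw [measureReal_def, measureReal_def,
      ← (measurePreserving_shift hν.1 (c.val : ℤ)).measure_preimage (hm c).nullMeasurableSet]
    congr 1
    refine measure_congr ?_
    filter_upwards [hν.2] with y hy
    simp only [eq_iff_iff]
    change φ (fun i => y (c.val + i)) = c ↔ φ (fun i => y i) = 0
    rw [hφ y hy]
    simp
  have hsum := sum_measureReal_preimage_singleton (μ := ν) Finset.univ
    (f := fun y : ℤ → A => φ fun i => y i) (fun c _ => hm c)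
  simp only [h0, Finset.sum_const, Finset.card_univ, ZMod.card, Finset.coe_univ, Set.preimage_univ,
    probReal_univ, nsmul_eq_mul] at hsum
  rw [h0, eq_div_iff (by exact_mod_cast NeZero.ne p), mul_comm]
  exact hsum

theorem le_measureReal_ne_of_mem_couplings (hd : 0 < diam F)
    (hφ : ∀ y ∈ sft (F : Set (Pattern A)), ∀ k : ℤ,
      φ (fun i => y (k + i)) = φ (fun i => y i) + k)
    {μ ν : Measure (ℤ → A)} [IsProbabilityMeasure μ] (hμ : Ergodic (shift (p : ℤ)) μ)
    (hν : ν ∈ sftMeasures (F : Set (Pattern A))) {l : Measure (ℤ → A × A)}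
    (hl : l ∈ couplings μ ν) :
    ((p : ℝ) - 1) / ((p : ℝ) * (diam F : ℝ)) ≤ l.real {z | (z 0).1 ≠ (z 0).2} := by
  obtain ⟨hinv, hl1, hl2⟩ := hl
  have := hinv.1
  have hp0 : (0 : ℝ) < p := by exact_mod_cast Nat.pos_of_ne_zero (NeZero.ne p)
  have hd0 : (0 : ℝ) < diam F := by exact_mod_cast hd
  let W : (ℤ → A) → ZMod p := fun y => φ fun i => y i
  have hm : ∀ c : ZMod p, MeasurableSet (W ⁻¹' {c}) :=
    fun c => measurableSet_window _ (φ ⁻¹' {c})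
  have hmp2 : MeasurePreserving proj₂ l ν := ⟨measurable_proj₂, hl2⟩
  have hph : ∀ c, l.real (proj₁ ⁻¹' (W ⁻¹' {c}) ∩ proj₂ ⁻¹' (W ⁻¹' {c})) =
      1 / p * μ.real (W ⁻¹' {c}) := by
    intro c
    -- Moving by `p` cells adds `p = 0` to the phase of the SFT side.
    have hE : shift (p : ℤ) ⁻¹' (proj₂ ⁻¹' (W ⁻¹' {c})) =ᵐ[l]
        (proj₂ ⁻¹' (W ⁻¹' {c}) : Set (ℤ → A × A)) := by
      have hae : ∀ᵐ z ∂l, proj₂ z ∈ sft (F : Set (Pattern A)) :=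
        hmp2.quasiMeasurePreserving.ae hν.2
      filter_upwards [hae] with z hz
      simp only [eq_iff_iff]
      change φ (fun i => proj₂ z (p + i)) = c ↔ φ (fun i => proj₂ z i) = c
      rw [hφ _ hz]
      simp
    have key := measure_preimage_inter_of_ergodic_factor (measurePreserving_shift hinv p) hμ
      ⟨measurable_proj₁, hl1⟩ (fun _ => rfl) (measurable_proj₂ (hm c)) hE (hm c)
    rw [measureReal_def, key, ENNReal.toReal_mul, ← measureReal_def, ← measureReal_def,
      ← measureReal_phase_eq hφ hν c, measureReal_def ν,
      ← hmp2.measure_preimage (hm c).nullMeasurableSet, measureReal_def]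
  have hagree : l.real (⋃ c ∈ (Finset.univ : Finset (ZMod p)),
      proj₁ ⁻¹' (W ⁻¹' {c}) ∩ proj₂ ⁻¹' (W ⁻¹' {c})) ≤ 1 / p := by
    refine (measureReal_biUnion_finset_le _ _).trans ?_
    simp only [hph]
    rw [← Finset.mul_sum, sum_measureReal_preimage_singleton _ fun c _ => hm c]
    simp
  have hne : l.real (⋃ i ∈ Finset.range (diam F), {z | (z (i : ℤ)).1 ≠ (z (i : ℤ)).2}) ≤
      diam F * l.real {z | (z 0).1 ≠ (z 0).2} := by
    refine (measureReal_biUnion_finset_le _ _).trans ?_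
    rw [Finset.sum_congr rfl (g := fun _ => l.real {z | (z 0).1 ≠ (z 0).2})]
    · simp
    · intro i _
      rw [measureReal_def, measureReal_def,
        ← (measurePreserving_shift hinv i).measure_preimage (measurableSet_ne 0).nullMeasurableSet]
      simp [shift]
  have hcover : (Set.univ : Set (ℤ → A × A)) ⊆ (⋃ c ∈ (Finset.univ : Finset (ZMod p)),
      proj₁ ⁻¹' (W ⁻¹' {c}) ∩ proj₂ ⁻¹' (W ⁻¹' {c})) ∪
      -- Equal words on cells `0, …, d(F) - 1` have equal phases, so a phase disagreement forces a
      -- mismatch on one of these cells.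
      ⋃ i ∈ Finset.range (diam F), {z | (z (i : ℤ)).1 ≠ (z (i : ℤ)).2} := by
    intro z _
    by_cases h : ∀ i < diam F, (z (i : ℤ)).1 = (z (i : ℤ)).2
    · left
      have hW : W (proj₁ z) = W (proj₂ z) := congrArg φ (funext fun i => h i i.2)
      simp [hW]
    · right
      push Not at h
      simpa using h
  have htot := (measureReal_mono (μ := l) hcover).trans (measureReal_union_le _ _)
  rw [probReal_univ] at htot
  rw [div_le_iff₀ (by positivity)]
  have h1 : 1 ≤ 1 / (p : ℝ) + diam F * l.real {z | (z 0).1 ≠ (z 0).2} := by linarith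
  have h2 := mul_le_mul_of_nonneg_left h1 hp0.le
  rw [mul_add, mul_one_div_cancel hp0.ne'] at h2
  linarith

/-- The uniform measure on the orbit of a periodic configuration of the subshift. -/
theorem sftMeasures_nonempty {F : Set (Pattern A)} (hF : F.Countable) {z : ℤ → A}
    (hz : z ∈ sft F) {n : ℕ}
    (hn : 0 < n) (hper : ∀ k : ℤ, z (k + n) = z k) : (sftMeasures F).Nonempty := by
  let κ : Measure (ℤ → A) := ∑ i ∈ Finset.range n, Measure.dirac (shift (i : ℤ) z)
  have hn0 : (n : ENNReal) ≠ 0 := by exact_mod_cast hn.ne'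
  have hκ1 : κ.map (shift 1) = κ := by
    have hz0 : shift (n : ℤ) z = shift ((0 : ℕ) : ℤ) z := by
      funext k
      simp [shift, add_comm (n : ℤ), hper]
    have hmap : κ.map (shift 1) =
        ∑ i ∈ Finset.range n, Measure.dirac (shift ((i + 1 : ℕ) : ℤ) z) := by
      rw [← Measure.mapₗ_apply_of_measurable (measurable_shift 1), map_sum]
      refine Finset.sum_congr rfl fun i _ => ?_
      rw [Measure.mapₗ_apply_of_measurable (measurable_shift 1),
        Measure.map_dirac' (measurable_shift 1), shift_shift]
      push_cast
      rfl
    -- Shifting the orbit sum sends its last term to the initial one, by periodicity.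
    obtain ⟨m, rfl⟩ := Nat.exists_eq_succ_of_ne_zero hn.ne'
    rw [hmap, Finset.sum_range_succ, hz0]
    exact (Finset.sum_range_succ' (fun i : ℕ => Measure.dirac (shift (i : ℤ) z)) m).symm
  have hprob : IsProbabilityMeasure ((n : ENNReal)⁻¹ • κ) := ⟨by
    simp [κ, Measure.finsetSum_apply, ENNReal.inv_mul_cancel hn0 (ENNReal.natCast_ne_top n)]⟩
  refine ⟨(n : ENNReal)⁻¹ • κ, mem_invariantMeasures_of_map_shift_one ?_, ?_⟩
  · rw [Measure.map_smul, hκ1]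
  · refine Measure.ae_smul_measure ?_ _
    rw [ae_iff, Measure.finsetSum_apply]
    refine Finset.sum_eq_zero fun i _ => ?_
    have hi : shift (i : ℤ) z ∈ sft F := fun w hw k => by
      rw [shift_shift]
      exact hz w hw _
    change Measure.dirac (shift (i : ℤ) z) (sft F)ᶜ = 0
    rw [Measure.dirac_apply' _ (measurableSet_sft hF).compl]
    exact Set.indicator_of_notMem (not_not_intro hi) _

theorem le_dBSet_sftMeasures (hd : 0 < diam F)
    (hφ : ∀ y ∈ sft (F : Set (Pattern A)), ∀ k : ℤ,
      φ (fun i => y (k + i)) = φ (fun i => y i) + k)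
    (hne : (sftMeasures (F : Set (Pattern A))).Nonempty)
    {μ : Measure (ℤ → A)} (hinv : μ ∈ invariantMeasures A) (hμ : Ergodic (shift (p : ℤ)) μ) :
    ((p : ℝ) - 1) / ((p : ℝ) * (diam F : ℝ)) ≤ dBSet μ (sftMeasures (F : Set (Pattern A))) := by
  have := hinv.1
  refine le_csInf (hne.image _) ?_
  rintro _ ⟨ν, hν, rfl⟩
  refine le_csInf ((couplings_nonempty hinv hν.1).image _) ?_
  rintro _ ⟨l, hl, rfl⟩
  exact (le_measureReal_ne_of_mem_couplings hd hφ hμ hν hl).trans (le_integral_dH hl.1)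

end Discrete

end

section

/-! ### Instability -/

theorem noisyMeasures_mono {A : Type*} [MeasurableSpace A] (F : Finset (Pattern A)) (ε : ℝ)
    (N : Set (Measure (ℤ → Bool))) :
    noisyMeasures F N ε ⊆ noisyMeasures F (invariantMeasures Bool) ε :=
  Set.image_mono fun _ h => ⟨h.1, h.2.2.1, h.2.2⟩

theorem IsStable.of_invariantMeasures {A : Type*} [MeasurableSpace A] {F : Finset (Pattern A)}
    (h : IsStable F (invariantMeasures Bool)) (N : Set (Measure (ℤ → Bool))) : IsStable F N := by
  obtain ⟨f, hf, hf0, hfc, hs⟩ := h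
  exact ⟨f, hf, hf0, hfc, fun ε μ hμ => hs ε μ (noisyMeasures_mono F ε N hμ)⟩

/-- A lower bound on the distance uniform in the noise level prevents stability. -/
theorem not_isStable_of_le_dBSet {A : Type*} [MeasurableSpace A] {F : Finset (Pattern A)}
    {N : Set (Measure (ℤ → Bool))} {c : ℝ} (hc : 0 < c)
    (h : ∀ ε : ℝ, 0 < ε → ∃ μ ∈ noisyMeasures F N ε,
      c ≤ dBSet μ (sftMeasures (F : Set (Pattern A)))) : ¬ IsStable F N := by
  rintro ⟨f, -, hf0, hfc, hs⟩
  have hlt : ∀ᶠ ε in nhds (0 : unitInterval), (f ε : ℝ) < c := by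
    have : Tendsto (fun ε => (f ε : ℝ)) (nhds 0) (nhds ((f 0 : NNReal) : ℝ)) :=
      (NNReal.continuous_coe.tendsto _).comp hfc
    rw [hf0] at this
    exact this.eventually_lt_const hc
  obtain ⟨δ, hδ, hball⟩ := Metric.eventually_nhds_iff.1 hlt
  let ε : unitInterval := ⟨min (δ / 2) 1, by positivity, min_le_right _ _⟩
  have hε : 0 < (ε : ℝ) := by simp only [ε]; positivity
  obtain ⟨μ, hμ, hle⟩ := h ε hε
  have hdist : dist ε 0 < δ := by
    rw [Subtype.dist_eq, Real.dist_eq, Set.Icc.coe_zero, sub_zero, abs_of_pos hε]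
    exact (min_le_left _ _).trans_lt (by linarith)
  have := hball hdist
  have := hs ε μ hμ
  linarith

theorem exists_noisyMeasure_le_dBSet {A : Type*} [Finite A] [MeasurableSpace A]
    [DiscreteMeasurableSpace A] {F : Finset (Pattern A)} {p : ℕ} (hp : 2 ≤ p)
    (hirr : Irreducible F) (hper : IsPeriod F p) {ε : ℝ} (hε : 0 < ε) :
    ∃ μ ∈ noisyMeasures F bernoulliNoises ε,
      ((p : ℝ) - 1) / ((p : ℝ) * (diam F : ℝ)) ≤ dBSet μ (sftMeasures (F : Set (Pattern A))) := by
  have : NeZero p := ⟨by omega⟩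
  have hd := diam_pos hp hirr hper
  obtain ⟨φ, hφ⟩ := exists_phase hirr hper
  obtain ⟨z, hz, n, hn, hzn⟩ := exists_periodic_mem_sft hd hirr
  let δ : unitInterval := ⟨min ε 1, by positivity, min_le_right _ _⟩
  have hδ : 0 < δ := Subtype.coe_lt_coe.1 (by simp only [δ, Set.Icc.coe_zero]; positivity)
  have hlift := restart_mem_noisyMeasuresLift hz hδ (min_le_left ε 1)
  refine ⟨_, ⟨_, hlift, rfl⟩, le_dBSet_sftMeasures hd hφ
    (sftMeasures_nonempty F.finite_toSet.countable hz hn hzn)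
    (map_mem_invariantMeasures hlift.1.1 measurable_proj₁ fun _ _ => rfl) ?_⟩
  have hr := measurable_restart (diam F) z
  beta_reduce
  rw [Measure.map_map measurable_proj₁ hr]
  -- Ergodicity under the `p`-th power of the shift passes from the Bernoulli noise to its
  -- equivariant image.
  refine MeasurePreserving.ergodic_of_ergodic_semiconj ⟨measurable_proj₁.comp hr, rfl⟩
    (ergodic_shift_infinitePi (bernoulliMeasure true false δ) (n := p) (by omega))
    (measurable_shift _) fun b => ?_
  rw [Function.comp_apply, restart_shift]
  rfl

end

end NoisySFT

end

theorem mainTheorem4 {A : Type*} [Finite A] [MeasurableSpace A] [DiscreteMeasurableSpace A]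
    (F : Finset (NoisySFT.Pattern A)) (p : ℕ) (hp : 2 ≤ p)
    (hirr : NoisySFT.Irreducible F) (hper : NoisySFT.IsPeriod F p) :
    (∀ ε : ℝ, 0 < ε →
      ∃ μ ∈ NoisySFT.noisyMeasures F NoisySFT.bernoulliNoises ε,
        ((p : ℝ) - 1) / ((p : ℝ) * (NoisySFT.diam F : ℝ)) - ε ≤
          NoisySFT.dBSet μ (NoisySFT.sftMeasures (F : Set (NoisySFT.Pattern A)))) ∧
    ¬ NoisySFT.IsStable F NoisySFT.bernoulliNoises ∧
    ¬ NoisySFT.IsStable F (NoisySFT.invariantMeasures Bool) := by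
  have hpos : 0 < ((p : ℝ) - 1) / ((p : ℝ) * (NoisySFT.diam F : ℝ)) := by
    have h1 : (2 : ℝ) ≤ p := by exact_mod_cast hp
    have h2 : (0 : ℝ) < NoisySFT.diam F := by exact_mod_cast NoisySFT.diam_pos hp hirr hper
    have h3 : (0 : ℝ) < p - 1 := by linarith
    positivity
  -- The bound here has no loss `-ε`, so its constant is uniform in the noise level, as instability
  -- requires.
  have key : ∀ ε : ℝ, 0 < ε → _ := fun ε hε =>
    NoisySFT.exists_noisyMeasure_le_dBSet hp hirr hper hε
  have hB := NoisySFT.not_isStable_of_le_dBSet hpos key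
  refine ⟨fun ε hε => ?_, hB, fun h => hB (h.of_invariantMeasures _)⟩
  obtain ⟨μ, hμ, hle⟩ := key ε hε
  exact ⟨μ, hμ, by linarith⟩
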